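/- Let $M$ be a smooth $n$-dimensional manifold with a Riemannian metric $g$, and let $\nabla$ be a torsion-free (smooth) affine connection on $M$ such that $(M,g,\nabla)$ is a statistical manifold, i.e. the cubic form $Q(X,Y,Z)=(\nabla_X g)(Y,Z)$ is symmetric in all three arguments. Let $\nabla^*$ be the dual connection of $\nabla$, i.e. the affine connection with $X\,g(Y,Z)=g(\nabla_X Y,Z)+g(Y,\nabla^*_X Z)$ for all smooth vector fields $X,Y,Z$. Let $Ric$ and $Ric^*$ be the Ricci tensors of $\nabla$ and $\nabla^*$, where $Ric(Y,Z)=\operatorname{tr}\{X\mapsto R(X,Y)Z\}$ and $R(X,Y)Z=\nabla_X\nabla_Y Z-\nabla_Y\nabla_X Z-\nabla_{[X,Y]}Z$, and similarly for $Ric^*$. If $(M,g,\nabla,\nabla^*)$ is conjugate Ricci-symmetric, i.e. $Ric(Y,Z)=Ric^*(Y,Z)$ for all vector fields $Y,Z$, then for every $\alpha\in\mathbb{R}$ the $\alpha$-connection $$\nabla^{(\alpha)}=\frac{1+\alpha}{2}\nabla+\frac{1-\alpha}{2}\nabla^*$$ is (locally) equiaffine: it is a torsion-free affine connection, and every point of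 $M$ has an open neighbourhood $U$ with a volume form $\omega$ on $U$ (a nowhere vanishing smooth $n$-form) that is parallel, $\nabla^{(\alpha)}\omega=0$ on $U$. -/

import Mathlib

open Bundle VectorField
open scoped Manifold ContDiff Topology

noncomputable section

namespace StatMfd

variable {n : ℕ} {M : Type*} [TopologicalSpace M] [ChartedSpace (EuclideanSpace ℝ (Fin n)) M]

/-- An affine connection on `M`, i.e. a covariant derivative on the tangent bundle. In Mathlib's
convention `D Y x (X x)` is `(∇_X Y)(x)`; values on non-differentiable fields are irrelevant. -/
abbrev AffineConnection (n : ℕ) (M : Type*) [TopologicalSpace M]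
    [ChartedSpace (EuclideanSpace ℝ (Fin n)) M] [IsManifold (𝓡 n) ∞ M] :=
  CovariantDerivative (𝓡 n) (EuclideanSpace ℝ (Fin n)) (TangentSpace (𝓡 n) : M → Type _)

/-- The affine connection `D` is of class `C^∞`. -/
abbrev AffineConnection.IsSmooth [IsManifold (𝓡 n) ∞ M] (D : AffineConnection n M) : Prop :=
  CovariantDerivative.ContMDiffCovariantDerivative D ∞

/-- The smooth vector fields on `M`. -/
abbrev SmoothVectorField (n : ℕ) (M : Type*) [TopologicalSpace M]
    [ChartedSpace (EuclideanSpace ℝ (Fin n)) M] [IsManifold (𝓡 n) ∞ M] :=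
  Cₛ^∞⟮𝓡 n; EuclideanSpace ℝ (Fin n), (TangentSpace (𝓡 n) : M → Type _)⟯

/-- A smooth Riemannian metric on `M`. -/
abbrev Metric (n : ℕ) (M : Type*) [TopologicalSpace M]
    [ChartedSpace (EuclideanSpace ℝ (Fin n)) M] [IsManifold (𝓡 n) ∞ M] :=
  ContMDiffRiemannianMetric (𝓡 n) ∞ (EuclideanSpace ℝ (Fin n))
    (fun x : M ↦ TangentSpace (𝓡 n) x)

variable [IsManifold (𝓡 n) ∞ M]

/-! ### Curvature and Ricci curvature -/

/-- `R(X, Y)Z = ∇_X ∇_Y Z - ∇_Y ∇_X Z - ∇_{[X, Y]} Z`. -/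
def curvature (D : AffineConnection n M) (X Y Z : Π x : M, TangentSpace (𝓡 n) x) (x : M) :
    TangentSpace (𝓡 n) x :=
  D (fun y ↦ D Z y (Y y)) x (X x) - D (fun y ↦ D Z y (X y)) x (Y x)
    - D Z x (mlieBracket (𝓡 n) X Y x)

theorem mdifferentiableAt_covDeriv (D : AffineConnection n M) (hD : D.IsSmooth)
    (Z : SmoothVectorField n M) {X : Π x : M, TangentSpace (𝓡 n) x} {x : M}
    (hX : MDifferentiableAt (𝓡 n) (𝓡 n).tangent (T% X) x) :
    MDifferentiableAt (𝓡 n) (𝓡 n).tangent (T% (fun y ↦ D Z y (X y))) x := by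
  have h := hD.contMDiff.contMDiff (σ := Z) (Z.contMDiff.contMDiffOn)
  have h' := (h.contMDiffAt Filter.univ_mem : ContMDiffAt _ _ _ _ x).mdifferentiableAt
    (by simp)
  exact h'.clm_bundle_apply hX

theorem tensorialAt_curvature (D : AffineConnection n M) (hD : D.IsSmooth)
    (Y Z : SmoothVectorField n M) (x : M) :
    TensorialAt (𝓡 n) (EuclideanSpace ℝ (Fin n)) (fun X ↦ curvature D X Y Z x) x where
  smul {f X} hf hX := by
    have e : (fun y ↦ D Z y ((f • X) y)) = f • (fun y ↦ D Z y (X y)) := by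
      ext1 y; simp
    unfold curvature
    rw [e, D.isCovariantDerivativeOn.leibniz (mdifferentiableAt_covDeriv D hD Z hX) hf,
      mlieBracket_smul_left hf hX]
    simp
    module
  add {X X'} hX hX' := by
    have e : (fun y ↦ D Z y ((X + X') y)) = (fun y ↦ D Z y (X y)) + (fun y ↦ D Z y (X' y)) := by
      ext1 y; simp
    unfold curvature
    rw [e, D.isCovariantDerivativeOn.add (mdifferentiableAt_covDeriv D hD Z hX)
      (mdifferentiableAt_covDeriv D hD Z hX'), mlieBracket_add_left hX hX']
    simp
    module

/-- The endomorphism `X ↦ R(X, Y)Z` of the tangent space at `x`. -/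
def curvatureEnd (D : AffineConnection n M) (hD : D.IsSmooth) (Y Z : SmoothVectorField n M)
    (x : M) : TangentSpace (𝓡 n) x →L[ℝ] TangentSpace (𝓡 n) x :=
  TensorialAt.mkHom (fun X ↦ curvature D X Y Z x) x (tensorialAt_curvature D hD Y Z x)

/-- The Ricci tensor `Ric(Y, Z) = tr (X ↦ R(X, Y)Z)`, evaluated at the point `x`. -/
def ricci (D : AffineConnection n M) (hD : D.IsSmooth) (Y Z : SmoothVectorField n M) (x : M) : ℝ :=
  LinearMap.trace ℝ (TangentSpace (𝓡 n) x) (curvatureEnd D hD Y Z x : _ →ₗ[ℝ] _)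

/-! ### Statistical manifolds -/

/-- The cubic form `Q(X, Y, Z) = (∇_X g)(Y, Z) = X(g(Y, Z)) - g(∇_X Y, Z) - g(Y, ∇_X Z)`. -/
def cubicForm (g : Metric n M) (D : AffineConnection n M) (X Y Z : SmoothVectorField n M)
    (x : M) : ℝ :=
  mvfderiv (𝓡 n) (fun y ↦ g.inner y (Y y) (Z y)) x (X x)
    - g.inner x (D Y x (X x)) (Z x) - g.inner x (Y x) (D Z x (X x))

/-- `(M, g, ∇)` is a statistical manifold: `∇` is torsion-free and the cubic form `∇g` is
symmetric in its three arguments. -/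
structure IsStatistical (g : Metric n M) (D : AffineConnection n M) : Prop where
  torsion_free : D.torsion = 0
  cubic_symm_left : ∀ X Y Z : SmoothVectorField n M, cubicForm g D X Y Z = cubicForm g D Y X Z
  cubic_symm_right : ∀ X Y Z : SmoothVectorField n M, cubicForm g D X Y Z = cubicForm g D X Z Y

/-- `D'` is the dual connection of `D` with respect to `g`:
`X(g(Y, Z)) = g(∇_X Y, Z) + g(Y, ∇*_X Z)`. -/
def IsDual (g : Metric n M) (D D' : AffineConnection n M) : Prop :=
  ∀ (X Y Z : SmoothVectorField n M) (x : M),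
    mvfderiv (𝓡 n) (fun y ↦ g.inner y (Y y) (Z y)) x (X x)
      = g.inner x (D Y x (X x)) (Z x) + g.inner x (Y x) (D' Z x (X x))

/-- Conjugate Ricci-symmetry: the Ricci tensors of the two connections coincide. -/
def ConjugateRicciSymmetric (D D' : AffineConnection n M) (hD : D.IsSmooth) (hD' : D'.IsSmooth) :
    Prop :=
  ∀ (Y Z : SmoothVectorField n M) (x : M), ricci D hD Y Z x = ricci D' hD' Y Z x

/-- The `α`-connection `((1 + α)/2) ∇ + ((1 - α)/2) ∇*`. -/
def alphaConnection (D D' : AffineConnection n M) (α : ℝ) : AffineConnection n M where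
  toFun Y x := ((1 + α) / 2) • D Y x + ((1 - α) / 2) • D' Y x
  isCovariantDerivativeOnUniv :=
    { add := fun hσ hσ' _ ↦ by
        rw [D.isCovariantDerivativeOn.add hσ hσ', D'.isCovariantDerivativeOn.add hσ hσ']
        module
      leibniz := fun hσ hf _ ↦ by
        rw [D.isCovariantDerivativeOn.leibniz hσ hf, D'.isCovariantDerivativeOn.leibniz hσ hf]
        module }

/-! ### Equiaffine connections -/

/-- A field of alternating `n`-forms on the tangent spaces of the `n`-dimensional manifold `M`. -/
abbrev TopForm (n : ℕ) (M : Type*) [TopologicalSpace M]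
    [ChartedSpace (EuclideanSpace ℝ (Fin n)) M] :=
  Π x : M, TangentSpace (𝓡 n) x [⋀^Fin n]→L[ℝ] ℝ

/-- The field of vectors `X` is smooth on `U`. -/
abbrev SmoothOn (U : Set M) (X : Π x : M, TangentSpace (𝓡 n) x) : Prop :=
  ContMDiffOn (𝓡 n) (𝓡 n).tangent ∞ (T% X) U

/-- `θ` is a volume form on the open set `U`: it is smooth on `U` (its values on smooth vector
fields on `U` are smooth functions) and nowhere zero on `U`. Values outside `U` are irrelevant. -/
structure IsVolumeFormOn (θ : TopForm n M) (U : Set M) : Prop where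
  smooth : ∀ Y : Fin n → Π x : M, TangentSpace (𝓡 n) x, (∀ i, SmoothOn U (Y i)) →
    ContMDiffOn (𝓡 n) 𝓘(ℝ, ℝ) ∞ (fun x ↦ θ x (fun i ↦ Y i x)) U
  ne_zero : ∀ x ∈ U, θ x ≠ 0

/-- `(∇_v θ)(Y₁, …, Yₙ) = v(θ(Y₁, …, Yₙ)) - ∑ᵢ θ(Y₁, …, ∇_v Yᵢ, …, Yₙ)` at the point `x`. -/
def covDerivForm (D : AffineConnection n M) (θ : TopForm n M) (x : M) (v : TangentSpace (𝓡 n) x)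
    (Y : Fin n → Π x : M, TangentSpace (𝓡 n) x) : ℝ :=
  mvfderiv (𝓡 n) (fun y ↦ θ y (fun i ↦ Y i y)) x v
    - ∑ i, θ x (Function.update (fun j ↦ Y j x) i (D (Y i) x v))

/-- `∇θ = 0` on the open set `U`. -/
def IsParallelOn (D : AffineConnection n M) (θ : TopForm n M) (U : Set M) : Prop :=
  ∀ Y : Fin n → Π x : M, TangentSpace (𝓡 n) x, (∀ i, SmoothOn U (Y i)) →
    ∀ x ∈ U, ∀ v : TangentSpace (𝓡 n) x, covDerivForm D θ x v Y = 0

/-- A (locally) equiaffine connection: a smooth torsion-free affine connection such that every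
point of `M` has an open neighbourhood carrying a parallel volume form. -/
structure IsEquiaffine (D : AffineConnection n M) : Prop where
  smooth : D.IsSmooth
  torsion_free : D.torsion = 0
  exists_parallel : ∀ p : M, ∃ U : Set M, IsOpen U ∧ p ∈ U ∧
    ∃ θ : TopForm n M, IsVolumeFormOn θ U ∧ IsParallelOn D θ U

end StatMfd

end

/-! In a coordinate frame `E` let τ be the trace of the connection form of ∇, τ(X) = tr(Y ↦ ω(X)Y),
and τ* that of ∇*. A form e^F dx¹∧…∧dxⁿ satisfies ∇(e^F dx) = (dF − τ) ⊗ e^F dx, so ∇ has a local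
parallel volume form as soon as τ is exact on a neighbourhood of each point.

Two relations force dτ = 0 and dτ* = 0. For a torsion-free connection the skew part of Ric is dτ up
to sign (`ricci_sub_ricci_swap`); hence Ric = Ric* gives dτ = dτ*. Taking the trace of the duality
relation gives τ + τ* = d log det g (`mvfderiv_log_det_inner`), hence dτ + dτ* = 0. The first
relation also needs ∇* to be torsion-free, which follows from the symmetry of the cubic form
(`torsion_dual_eq_zero`).

On a coordinate ball the Poincaré lemma then gives τ = df and τ* = df*. The trace form is affine in
the connection, so (1+α)/2·f + (1−α)/2·f* is a potential for the trace form of ∇^(α), and its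
exponential times the coordinate volume is parallel (`isParallelOn_expVolume`).

Ricci tensors, duality and the cubic form are tested on global smooth fields only, so coordinate
fields are first cut off by a bump function. -/

noncomputable section

namespace StatMfd

/-! ### Determinants and derivatives of functions on the manifold -/

theorem sum_det_updateRow {ι : Type*} [Fintype ι] [DecidableEq ι] (G H : Matrix ι ι ℝ) :
    ∑ i, (G.updateRow i (H i)).det = (H * G.adjugate).trace := by
  simp only [Matrix.trace, Matrix.diag_apply, Matrix.mul_apply]
  refine Finset.sum_congr rfl fun i _ ↦ ?_
  -- Cramer's rule: replacing row i by b gives the i-th entry of the adjugate of Gᵀ applied to b.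
  rw [← Matrix.cramer_transpose_apply, Matrix.cramer_eq_adjugate_mulVec, Matrix.mulVec,
    dotProduct, ← Matrix.adjugate_transpose]
  exact Finset.sum_congr rfl fun j _ ↦ mul_comm _ _

/-- The determinant as a continuous alternating map of the rows. -/
def detForm (n : ℕ) : (Fin n → ℝ) [⋀^Fin n]→L[ℝ] ℝ where
  toMultilinearMap := (Matrix.detRowAlternating (n := Fin n) (R := ℝ)).toMultilinearMap
  cont := Continuous.matrix_det continuous_id
  map_eq_zero_of_eq' := Matrix.detRowAlternating.map_eq_zero_of_eq'

theorem detForm_apply {n : ℕ} (A : Fin n → Fin n → ℝ) : detForm n A = (Matrix.of A).det := rfl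

variable {n : ℕ} {M : Type*} [TopologicalSpace M] [ChartedSpace (EuclideanSpace ℝ (Fin n)) M]

theorem mvfderiv_congr {f g : M → ℝ} {x : M} (h : f =ᶠ[𝓝 x] g) (w : TangentSpace (𝓡 n) x) :
    mvfderiv (𝓡 n) f x w = mvfderiv (𝓡 n) g x w := by
  have h1 := h.mfderiv_eq (I := 𝓡 n) (I' := 𝓘(ℝ, ℝ))
  exact DFunLike.congr_fun h1 w

theorem mvfderiv_hasFDerivAt_comp {F F' : Type*} [NormedAddCommGroup F] [NormedSpace ℝ F]
    [NormedAddCommGroup F'] [NormedSpace ℝ F'] {G : F → F'} {G' : F →L[ℝ] F'} {f : M → F} {x : M}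
    (hG : HasFDerivAt G G' (f x)) (hf : MDifferentiableAt (𝓡 n) 𝓘(ℝ, F) f x)
    (v : TangentSpace (𝓡 n) x) :
    mvfderiv (𝓡 n) (fun y ↦ G (f y)) x v = G' (mvfderiv (𝓡 n) f x v) := by
  have h1 := hG.hasMFDerivAt.comp x hf.hasMFDerivAt
  exact DFunLike.congr_fun (h1.mfderiv) v

/-- Jacobi's formula along a map into matrices. -/
theorem mvfderiv_det {A : M → Fin n → Fin n → ℝ} {x : M}
    (hA : ∀ i j, ContMDiffAt (𝓡 n) 𝓘(ℝ, ℝ) ∞ (fun y ↦ A y i j) x)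
    (v : TangentSpace (𝓡 n) x) :
    mvfderiv (𝓡 n) (fun y ↦ detForm n (A y)) x v
      = ((Matrix.of fun i j ↦ mvfderiv (𝓡 n) (fun y ↦ A y i j) x v) *
          (Matrix.of (A x)).adjugate).trace := by
  have hA' : MDifferentiableAt (𝓡 n) 𝓘(ℝ, Fin n → Fin n → ℝ) A x :=
    (contMDiffAt_pi_space.2 fun i ↦ contMDiffAt_pi_space.2 fun j ↦ hA i j).mdifferentiableAt
      (by simp)
  refine (mvfderiv_hasFDerivAt_comp ((detForm n).toContinuousMultilinearMap.hasFDerivAt (A x)) hA'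
    v).trans ?_
  rw [ContinuousMultilinearMap.linearDeriv_apply, ← sum_det_updateRow]
  refine Finset.sum_congr rfl fun i _ ↦ ?_
  have : mvfderiv (𝓡 n) A x v i = fun j ↦ mvfderiv (𝓡 n) (fun y ↦ A y i j) x v := by
    ext j
    exact (mvfderiv_hasFDerivAt_comp (((ContinuousLinearMap.proj j : (Fin n → ℝ) →L[ℝ] ℝ).comp
      (ContinuousLinearMap.proj i : (Fin n → Fin n → ℝ) →L[ℝ] _)).hasFDerivAt) hA' v).symm
  rw [this]
  rfl

theorem contMDiffAt_detForm {A : M → Fin n → Fin n → ℝ} {x : M}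
    (hA : ∀ i j, ContMDiffAt (𝓡 n) 𝓘(ℝ, ℝ) ∞ (fun y ↦ A y i j) x) :
    ContMDiffAt (𝓡 n) 𝓘(ℝ, ℝ) ∞ (fun y ↦ detForm n (A y)) x :=
  (detForm n).toContinuousMultilinearMap.contDiff.contMDiff.contMDiffAt.comp x
    (contMDiffAt_pi_space.2 fun i ↦ contMDiffAt_pi_space.2 fun j ↦ hA i j)

theorem mvfderiv_finsetSum {ι : Type} (S : Finset ι) {f : ι → M → ℝ} {x : M}
    (hf : ∀ i, MDifferentiableAt (𝓡 n) 𝓘(ℝ, ℝ) (f i) x) (v : TangentSpace (𝓡 n) x) :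
    mvfderiv (𝓡 n) (fun y ↦ ∑ i ∈ S, f i y) x v = ∑ i ∈ S, mvfderiv (𝓡 n) (f i) x v := by
  classical
  induction S using Finset.induction_on with
  | empty => simp [mvfderiv_const]
  | insert a S ha ih =>
    simp only [Finset.sum_insert ha]
    have hS : MDifferentiableAt (𝓡 n) 𝓘(ℝ, ℝ) (∑ i ∈ S, f i) x :=
      MDifferentiableAt.sum fun i _ ↦ hf i
    have h := mvfderiv_add (hf a) hS
    rw [← ih]
    have h' := DFunLike.congr_fun h v
    rw [Finset.sum_fn] at h'
    exact h'

theorem mvfderiv_linear_combination {f g : M → ℝ} {x : M}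
    (hf : MDifferentiableAt (𝓡 n) 𝓘(ℝ, ℝ) f x) (hg : MDifferentiableAt (𝓡 n) 𝓘(ℝ, ℝ) g x)
    (a b : ℝ) (v : TangentSpace (𝓡 n) x) :
    mvfderiv (𝓡 n) (fun y ↦ a * f y + b * g y) x v
      = a * mvfderiv (𝓡 n) f x v + b * mvfderiv (𝓡 n) g x v := by
  have hm {f : M → ℝ} (hf : MDifferentiableAt (𝓡 n) 𝓘(ℝ, ℝ) f x) (a : ℝ) :
      mvfderiv (𝓡 n) (fun y ↦ a * f y) x v = a * mvfderiv (𝓡 n) f x v :=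
    mvfderiv_hasFDerivAt_comp (a • ContinuousLinearMap.id ℝ ℝ).hasFDerivAt hf v
  have hmd {f : M → ℝ} (hf : MDifferentiableAt (𝓡 n) 𝓘(ℝ, ℝ) f x) (a : ℝ) :
      MDifferentiableAt (𝓡 n) 𝓘(ℝ, ℝ) (fun y ↦ a * f y) x :=
    (a • ContinuousLinearMap.id ℝ ℝ).differentiableAt.mdifferentiableAt.comp x hf
  rw [← hm hf, ← hm hg]
  exact DFunLike.congr_fun (mvfderiv_add (hmd hf a) (hmd hg b)) v

/-! ### Coordinate fields of a chart and the Poincaré lemma -/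

variable [IsManifold (𝓡 n) ∞ M]

/-- The derivative at `x` of the chart at `p`. -/
def chartDeriv (p x : M) : TangentSpace (𝓡 n) x →L[ℝ] EuclideanSpace ℝ (Fin n) :=
  mvfderiv (𝓡 n) (extChartAt (𝓡 n) p) x

/-- The `i`-th coordinate of a tangent vector at `x` in the chart at `p`. -/
def chartCoeff (p : M) (i : Fin n) (x : M) : TangentSpace (𝓡 n) x →L[ℝ] ℝ :=
  (EuclideanSpace.proj i : EuclideanSpace ℝ (Fin n) →L[ℝ] ℝ).comp (chartDeriv p x)

/-- The `i`-th coordinate vector field of the chart at `p`. -/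
def chartField (p : M) (i : Fin n) (x : M) : TangentSpace (𝓡 n) x :=
  (chartDeriv p x).inverse (EuclideanSpace.single i (1 : ℝ))

theorem isInvertible_chartDeriv {p x : M} (hx : x ∈ (extChartAt (𝓡 n) p).source) :
    (chartDeriv (n := n) p x).IsInvertible :=
  isInvertible_mfderiv_extChartAt hx

theorem chartDeriv_chartField {p x : M} (hx : x ∈ (extChartAt (𝓡 n) p).source) (i : Fin n) :
    chartDeriv p x (chartField p i x) = EuclideanSpace.single i (1 : ℝ) := by
  unfold chartField
  exact (isInvertible_chartDeriv hx).self_apply_inverse _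

theorem chartCoeff_chartField {p x : M} (hx : x ∈ (extChartAt (𝓡 n) p).source) (i j : Fin n) :
    chartCoeff p i x (chartField p j x) = if i = j then 1 else 0 := by
  simp [chartCoeff, chartDeriv_chartField hx]

theorem sum_chartCoeff_smul {p x : M} (hx : x ∈ (extChartAt (𝓡 n) p).source)
    (w : TangentSpace (𝓡 n) x) : ∑ i, chartCoeff p i x w • chartField p i x = w := by
  apply (isInvertible_chartDeriv hx).injective
  ext j
  simp [chartDeriv_chartField hx, chartCoeff, Pi.single_apply]

/-- Near x the chart derivative is the fibre part of the trivialization of the tangent bundle at p,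
in which smooth sections have smooth components. -/
theorem contMDiffAt_chartCoeff {p x : M} (hx : x ∈ (extChartAt (𝓡 n) p).source) (i : Fin n)
    {s : Π x : M, TangentSpace (𝓡 n) x} (hs : ContMDiffAt (𝓡 n) (𝓡 n).tangent ∞ (T% s) x) :
    ContMDiffAt (𝓡 n) 𝓘(ℝ, ℝ) ∞ (fun y ↦ chartCoeff p i y (s y)) x := by
  have hx' : x ∈ (trivializationAt (EuclideanSpace ℝ (Fin n)) (TangentSpace (𝓡 n)) p).baseSet := by
    simpa using hx
  have h := (Bundle.Trivialization.contMDiffAt_section_iff _ hx').1 hs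
  have h2 := (EuclideanSpace.proj i : EuclideanSpace ℝ (Fin n) →L[ℝ] ℝ).contMDiff.contMDiffAt.comp
    (n := ∞) x h
  refine h2.congr_of_eventuallyEq ?_
  filter_upwards [(isOpen_extChartAt_source (I := 𝓡 n) p).mem_nhds hx] with y hy
  have := TangentBundle.continuousLinearMapAt_trivializationAt (I := 𝓡 n) (by simpa using hy)
  have h3 := DFunLike.congr_fun this (s y)
  have h4 := Trivialization.continuousLinearMapAt_apply_of_mem (R := ℝ)
    (trivializationAt (EuclideanSpace ℝ (Fin n)) (TangentSpace (𝓡 n)) p) (b := y)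
    (by simpa using hy) (s y)
  exact congrArg (EuclideanSpace.proj i : EuclideanSpace ℝ (Fin n) →L[ℝ] ℝ) (h3.symm.trans h4)

theorem contMDiffAt_chartField {p x : M} (hx : x ∈ (extChartAt (𝓡 n) p).source) (i : Fin n) :
    ContMDiffAt (𝓡 n) (𝓡 n).tangent ∞ (T% (chartField p i)) x := by
  refine ContMDiffAt.mpullback_vectorField_preimage (n := ∞)
    (V := fun _ ↦ (EuclideanSpace.single i (1 : ℝ) : EuclideanSpace ℝ (Fin n))) ?_
    (contMDiffAt_extChartAt' (by simpa using hx)) (isInvertible_mfderiv_extChartAt hx) (by simp)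
  exact contMDiffAt_vectorSpace_iff_contDiffAt.2 contDiffAt_const

/-- Coordinate fields are pullbacks of constant fields; pullback respects brackets, and constant
fields commute. -/
theorem mlieBracket_chartField {p x : M} (hx : x ∈ (extChartAt (𝓡 n) p).source) (i j : Fin n) :
    mlieBracket (𝓡 n) (chartField p i) (chartField p j) x = 0 := by
  have : IsManifold (𝓡 n) (minSmoothness ℝ 2) M := by
    rw [minSmoothness_of_isRCLikeNormedField]; infer_instance
  have : IsManifold (𝓡 n) (minSmoothness ℝ 3) M := by
    rw [minSmoothness_of_isRCLikeNormedField]; infer_instance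
  have hc (v : EuclideanSpace ℝ (Fin n)) (y : EuclideanSpace ℝ (Fin n)) :
      MDifferentiableAt (𝓡 n) (𝓡 n).tangent
        (fun y ↦ (⟨y, v⟩ : TangentBundle (𝓡 n) (EuclideanSpace ℝ (Fin n)))) y :=
    (contMDiffAt_vectorSpace_iff_contDiffAt (n := 1).2 contDiffAt_const).mdifferentiableAt (by simp)
  have h := mpullback_mlieBracket (n := 2) (I := 𝓡 n) (f := extChartAt (𝓡 n) p) (x₀ := x)
    (V := fun _ ↦ (EuclideanSpace.single i (1 : ℝ) : EuclideanSpace ℝ (Fin n)))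
    (W := fun _ ↦ (EuclideanSpace.single j (1 : ℝ) : EuclideanSpace ℝ (Fin n)))
    (hc _ _) (hc _ _) (contMDiffAt_extChartAt' (by simpa using hx))
    (by simp)
  refine h.symm.trans ?_
  have h0 : mlieBracket (M := EuclideanSpace ℝ (Fin n)) (𝓡 n)
      (fun _ ↦ (EuclideanSpace.single i (1 : ℝ) : EuclideanSpace ℝ (Fin n)))
      (fun _ ↦ (EuclideanSpace.single j (1 : ℝ) : EuclideanSpace ℝ (Fin n))) = 0 := by
    refine mlieBracketWithin_univ.symm.trans (mlieBracketWithin_eq_lieBracketWithin.trans ?_)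
    ext1 y
    simp [lieBracketWithin]
    rfl
  rw [mpullback_apply]
  refine (congrArg _ (congrFun h0 _)).trans ?_
  exact map_zero _

theorem mvfderiv_eq_fderiv_chart {p x : M} (hx : x ∈ (extChartAt (𝓡 n) p).source) {f : M → ℝ}
    (hf : MDifferentiableAt (𝓡 n) 𝓘(ℝ, ℝ) f x) (w : TangentSpace (𝓡 n) x) :
    mvfderiv (𝓡 n) f x w = fderiv ℝ (f ∘ (extChartAt (𝓡 n) p).symm) (extChartAt (𝓡 n) p x)
      (chartDeriv p x w) := by
  have hφ : MDifferentiableAt (𝓡 n) (𝓡 n) (extChartAt (𝓡 n) p) x :=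
    mdifferentiableAt_extChartAt (by simpa using hx)
  have hψ : MDifferentiableAt (𝓡 n) (𝓡 n) (extChartAt (𝓡 n) p).symm (extChartAt (𝓡 n) p x) :=
    ((contMDiffOn_extChartAt_symm (n := 1) p).contMDiffAt
      ((isOpen_extChartAt_target p).mem_nhds ((extChartAt (𝓡 n) p).map_source hx))).mdifferentiableAt
      (by simp)
  have hF : MDifferentiableAt (𝓡 n) 𝓘(ℝ, ℝ) (f ∘ (extChartAt (𝓡 n) p).symm)
      (extChartAt (𝓡 n) p x) := by
    refine MDifferentiableAt.comp _ ?_ hψ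
    rwa [(extChartAt (𝓡 n) p).left_inv hx]
  have he : f =ᶠ[𝓝 x] (f ∘ (extChartAt (𝓡 n) p).symm) ∘ extChartAt (𝓡 n) p := by
    filter_upwards [(isOpen_extChartAt_source (I := 𝓡 n) p).mem_nhds hx] with y hy
    exact congrArg f ((extChartAt (𝓡 n) p).left_inv hy).symm
  have h1 := (hF.hasMFDerivAt.comp x hφ.hasMFDerivAt).congr_of_eventuallyEq he
  have h2 := DFunLike.congr_fun (h1.mfderiv) w
  rw [mfderiv_eq_fderiv] at h2
  exact h2

theorem contDiffAt_comp_chart_symm {p x : M} (hx : x ∈ (extChartAt (𝓡 n) p).source) {f : M → ℝ}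
    (hf : ContMDiffAt (𝓡 n) 𝓘(ℝ, ℝ) ∞ f x) :
    ContDiffAt ℝ ∞ (f ∘ (extChartAt (𝓡 n) p).symm) (extChartAt (𝓡 n) p x) := by
  have hψ : ContMDiffAt (𝓡 n) (𝓡 n) ∞ (extChartAt (𝓡 n) p).symm (extChartAt (𝓡 n) p x) :=
    (contMDiffOn_extChartAt_symm p).contMDiffAt
      ((isOpen_extChartAt_target p).mem_nhds ((extChartAt (𝓡 n) p).map_source hx))
  refine ContMDiffAt.contDiffAt (ContMDiffAt.comp _ ?_ hψ)
  rwa [(extChartAt (𝓡 n) p).left_inv hx]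

theorem mvfderiv_comp_chart {p x : M} (hx : x ∈ (extChartAt (𝓡 n) p).source)
    {G : EuclideanSpace ℝ (Fin n) → ℝ} (hG : DifferentiableAt ℝ G (extChartAt (𝓡 n) p x))
    (i : Fin n) :
    mvfderiv (𝓡 n) (G ∘ extChartAt (𝓡 n) p) x (chartField p i x)
      = fderiv ℝ G (extChartAt (𝓡 n) p x) (EuclideanSpace.single i 1) := by
  have hφ : MDifferentiableAt (𝓡 n) (𝓡 n) (extChartAt (𝓡 n) p) x :=
    mdifferentiableAt_extChartAt (by simpa using hx)
  rw [mvfderiv_eq_fderiv_chart hx (hG.mdifferentiableAt.comp x hφ), chartDeriv_chartField hx]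
  congr 1
  refine Filter.EventuallyEq.fderiv_eq ?_
  filter_upwards [(isOpen_extChartAt_target p).mem_nhds ((extChartAt (𝓡 n) p).map_source hx)]
    with z hz
  exact congrArg G ((extChartAt (𝓡 n) p).right_inv hz)

theorem mvfderiv_mvfderiv_chartField {p : M} {U : Set M} (hU : IsOpen U)
    (hUs : U ⊆ (extChartAt (𝓡 n) p).source) {f : M → ℝ}
    (hf : ContMDiffOn (𝓡 n) 𝓘(ℝ, ℝ) ∞ f U) {x : M} (hx : x ∈ U) (i j : Fin n) :
    mvfderiv (𝓡 n) (fun y ↦ mvfderiv (𝓡 n) f y (chartField p j y)) x (chartField p i x)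
      = fderiv ℝ (fderiv ℝ (f ∘ (extChartAt (𝓡 n) p).symm)) (extChartAt (𝓡 n) p x)
        (EuclideanSpace.single i 1) (EuclideanSpace.single j 1) := by
  have hF := contDiffAt_comp_chart_symm (hUs hx) (hf.contMDiffAt (hU.mem_nhds hx))
  have hd : DifferentiableAt ℝ (fderiv ℝ (f ∘ (extChartAt (𝓡 n) p).symm))
      (extChartAt (𝓡 n) p x) :=
    (hF.fderiv_right (m := 1) (by rw [one_add_one_eq_two]; exact ENat.LEInfty.out)).differentiableAt
      (by simp)
  have he : (fun y ↦ mvfderiv (𝓡 n) f y (chartField p j y)) =ᶠ[𝓝 x]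
      (fun z ↦ fderiv ℝ (f ∘ (extChartAt (𝓡 n) p).symm) z (EuclideanSpace.single j 1))
        ∘ extChartAt (𝓡 n) p := by
    filter_upwards [hU.mem_nhds hx] with y hy
    rw [mvfderiv_eq_fderiv_chart (hUs hy)
      ((hf.contMDiffAt (hU.mem_nhds hy)).mdifferentiableAt (by simp)),
      chartDeriv_chartField (hUs hy)]
    rfl
  rw [mvfderiv_congr he, mvfderiv_comp_chart (hUs hx) (hd.clm_apply (differentiableAt_const _)),
    fderiv_clm_apply hd (differentiableAt_const _)]
  simp

/-- Both sides are second partial derivatives of f read in the chart, so this is the symmetry of the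
second derivative. -/
theorem mvfderiv_chartField_comm {p : M} {U : Set M} (hU : IsOpen U)
    (hUs : U ⊆ (extChartAt (𝓡 n) p).source) {f : M → ℝ}
    (hf : ContMDiffOn (𝓡 n) 𝓘(ℝ, ℝ) ∞ f U) {x : M} (hx : x ∈ U) (i j : Fin n) :
    mvfderiv (𝓡 n) (fun y ↦ mvfderiv (𝓡 n) f y (chartField p j y)) x (chartField p i x)
      = mvfderiv (𝓡 n) (fun y ↦ mvfderiv (𝓡 n) f y (chartField p i y)) x (chartField p j x) := by
  rw [mvfderiv_mvfderiv_chartField hU hUs hf hx, mvfderiv_mvfderiv_chartField hU hUs hf hx]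
  exact (contDiffAt_comp_chart_symm (hUs hx) (hf.contMDiffAt (hU.mem_nhds hx))).isSymmSndFDerivAt
    (by rw [minSmoothness_of_isRCLikeNormedField]; exact ENat.LEInfty.out) _ _

/-- The Poincaré lemma on a coordinate ball. -/
theorem exists_potential {p : M} {r : ℝ}
    (hr : Metric.ball (extChartAt (𝓡 n) p p) r ⊆ (extChartAt (𝓡 n) p).target)
    {U : Set M} (hU : U = (extChartAt (𝓡 n) p).source ∩
      extChartAt (𝓡 n) p ⁻¹' Metric.ball (extChartAt (𝓡 n) p p) r) (hUo : IsOpen U)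
    (a : Fin n → M → ℝ) (ha : ∀ i, ContMDiffOn (𝓡 n) 𝓘(ℝ, ℝ) ∞ (a i) U)
    (hcl : ∀ x ∈ U, ∀ i j, mvfderiv (𝓡 n) (a j) x (chartField p i x)
      = mvfderiv (𝓡 n) (a i) x (chartField p j x)) :
    ∃ f : M → ℝ, ContMDiffOn (𝓡 n) 𝓘(ℝ, ℝ) ∞ f U ∧
      ∀ x ∈ U, ∀ i, mvfderiv (𝓡 n) f x (chartField p i x) = a i x := by
  set φ := extChartAt (𝓡 n) p with hφ
  set B := Metric.ball (φ p) r with hB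
  have hUs : U ⊆ φ.source := by rw [hU]; exact Set.inter_subset_left
  have hmem {z : EuclideanSpace ℝ (Fin n)} (hz : z ∈ B) : φ.symm z ∈ U := by
    rw [hU]
    refine ⟨φ.map_target (hr hz), ?_⟩
    rw [Set.mem_preimage, φ.right_inv (hr hz)]
    exact hz
  have hsm (i : Fin n) {z : EuclideanSpace ℝ (Fin n)} (hz : z ∈ B) :
      ContDiffAt ℝ ∞ (a i ∘ φ.symm) z := by
    have := contDiffAt_comp_chart_symm (hUs (hmem hz))
      ((ha i).contMDiffAt (hUo.mem_nhds (hmem hz)))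
    rwa [← hφ, φ.right_inv (hr hz)] at this
  have hder (i j : Fin n) {z : EuclideanSpace ℝ (Fin n)} (hz : z ∈ B) :
      fderiv ℝ (a i ∘ φ.symm) z (EuclideanSpace.single j 1)
        = mvfderiv (𝓡 n) (a i) (φ.symm z) (chartField p j (φ.symm z)) := by
    rw [mvfderiv_eq_fderiv_chart (hUs (hmem hz))
      (((ha i).contMDiffAt (hUo.mem_nhds (hmem hz))).mdifferentiableAt (by simp)),
      chartDeriv_chartField (hUs (hmem hz)), ← hφ, φ.right_inv (hr hz)]
  -- The one-form Σ aᵢ dxⁱ in coordinates. Its closedness is the symmetry of its derivative, which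
  -- `hcl` supplies on basis vectors.
  let η : EuclideanSpace ℝ (Fin n) → EuclideanSpace ℝ (Fin n) →L[ℝ] ℝ := fun z ↦
    ∑ i, (a i ∘ φ.symm) z • (EuclideanSpace.proj i : EuclideanSpace ℝ (Fin n) →L[ℝ] ℝ)
  have hη {z} (hz : z ∈ B) : ContDiffAt ℝ ∞ η z :=
    ContDiffAt.sum fun i _ ↦ (hsm i hz).smul contDiffAt_const
  have hηd {z} (hz : z ∈ B) (u v : EuclideanSpace ℝ (Fin n)) :
      fderiv ℝ η z u v = ∑ i, fderiv ℝ (a i ∘ φ.symm) z u * v i := by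
    have h := HasFDerivAt.fun_sum (u := Finset.univ) fun i _ ↦
      (((hsm i hz).differentiableAt (by simp)).hasFDerivAt.smul_const
        (EuclideanSpace.proj i : EuclideanSpace ℝ (Fin n) →L[ℝ] ℝ))
    rw [show fderiv ℝ η z = _ from h.fderiv]
    simp [_root_.sum_apply]
  have hexp (L : EuclideanSpace ℝ (Fin n) →L[ℝ] ℝ) (u : EuclideanSpace ℝ (Fin n)) :
      L u = ∑ j, u j * L (EuclideanSpace.single j 1) := by
    conv_lhs => rw [← (EuclideanSpace.basisFun (Fin n) ℝ).sum_repr u]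
    simp
  obtain ⟨F, hF⟩ := (convex_ball (φ p) r).exists_forall_hasFDerivAt_of_fderiv_symmetric
    Metric.isOpen_ball
    (show DifferentiableOn ℝ η _ from
      fun z hz ↦ ((hη hz).differentiableAt (by simp)).differentiableWithinAt) (by
      intro z hz u v
      rw [hηd hz, hηd hz]
      simp_rw [hexp _ u, hexp _ v, Finset.sum_mul]
      rw [Finset.sum_comm]
      refine Finset.sum_congr rfl fun i _ ↦ Finset.sum_congr rfl fun j _ ↦ ?_
      rw [hder _ _ hz, hder _ _ hz, hcl _ (hmem hz)]
      ring)
  -- The derivative of F on the ball is η, which is smooth.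
  have hFs : ContDiffOn ℝ ∞ F B := by
    refine (contDiffOn_infty_iff_fderiv_of_isOpen Metric.isOpen_ball).2
      ⟨fun z hz ↦ (hF z hz).differentiableAt.differentiableWithinAt, ?_⟩
    exact ContDiffOn.congr (f := η) (fun z hz ↦ (hη hz).contDiffWithinAt)
      fun z hz ↦ (hF z hz).fderiv
  have hUB {x : M} (hx : x ∈ U) : φ x ∈ B := by rw [hU] at hx; exact hx.2
  refine ⟨F ∘ φ, fun x hx ↦ ?_, fun x hx i ↦ ?_⟩
  · have h1 : ContMDiffAt (𝓡 n) 𝓘(ℝ, ℝ) ∞ F (φ x) :=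
      (hFs.contDiffAt (Metric.isOpen_ball.mem_nhds (hUB hx))).contMDiffAt
    exact (h1.comp x (contMDiffAt_extChartAt' (by simpa [hφ] using hUs hx))).contMDiffWithinAt
  · rw [mvfderiv_comp_chart (hUs hx) (hF _ (hUB hx)).differentiableAt, (hF _ (hUB hx)).fderiv]
    simp [η, φ.left_inv (hUs hx)]

/-- Globally defined smooth fields `E i` which are the coordinate fields of some chart on the open
set `U`, with dual coframe `c i`; `U` is such that closed one-forms on it are exact. -/
structure IsCoordinateFrame (U : Set M) (E : Fin n → SmoothVectorField n M)
    (c : Fin n → Π x : M, TangentSpace (𝓡 n) x →L[ℝ] ℝ) : Prop where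
  isOpen : IsOpen U
  coeff_frame : ∀ x ∈ U, ∀ i j, c i x (E j x) = if i = j then 1 else 0
  sum_coeff_smul : ∀ x ∈ U, ∀ w : TangentSpace (𝓡 n) x, ∑ i, c i x w • E i x = w
  contMDiffAt_coeff : ∀ x ∈ U, ∀ s : Π x : M, TangentSpace (𝓡 n) x,
    ContMDiffAt (𝓡 n) (𝓡 n).tangent ∞ (T% s) x → ∀ i,
      ContMDiffAt (𝓡 n) 𝓘(ℝ, ℝ) ∞ (fun y ↦ c i y (s y)) x
  mlieBracket_eq_zero : ∀ x ∈ U, ∀ i j, mlieBracket (𝓡 n) (E i) (E j) x = 0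
  mvfderiv_comm : ∀ f : M → ℝ, ContMDiffOn (𝓡 n) 𝓘(ℝ, ℝ) ∞ f U → ∀ x ∈ U, ∀ i j,
    mvfderiv (𝓡 n) (fun y ↦ mvfderiv (𝓡 n) f y (E j y)) x (E i x)
      = mvfderiv (𝓡 n) (fun y ↦ mvfderiv (𝓡 n) f y (E i y)) x (E j x)
  exists_potential : ∀ a : Fin n → M → ℝ, (∀ i, ContMDiffOn (𝓡 n) 𝓘(ℝ, ℝ) ∞ (a i) U) →
    (∀ x ∈ U, ∀ i j, mvfderiv (𝓡 n) (a j) x (E i x) = mvfderiv (𝓡 n) (a i) x (E j x)) →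
    ∃ f : M → ℝ, ContMDiffOn (𝓡 n) 𝓘(ℝ, ℝ) ∞ f U ∧
      ∀ x ∈ U, ∀ i, mvfderiv (𝓡 n) f x (E i x) = a i x

theorem exists_isCoordinateFrame [T2Space M] (p : M) :
    ∃ (U : Set M) (E : Fin n → SmoothVectorField n M)
      (c : Fin n → Π x : M, TangentSpace (𝓡 n) x →L[ℝ] ℝ), p ∈ U ∧ IsCoordinateFrame U E c := by
  -- The fields ρ · ∂ᵢ are globally smooth because the support of ρ lies in the chart domain, and
  -- equal ∂ᵢ on U because ρ = 1 on the ball of radius `rIn`.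
  let ρ : SmoothBumpFunction (𝓡 n) p := Classical.arbitrary _
  let φ := extChartAt (𝓡 n) p
  let U : Set M := φ.source ∩ φ ⁻¹' Metric.ball (φ p) ρ.rIn
  have hUo : IsOpen U := isOpen_extChartAt_preimage' p Metric.isOpen_ball
  have hUs : U ⊆ φ.source := Set.inter_subset_left
  have hρ {x : M} (hx : x ∈ U) : ρ x = 1 :=
    ρ.one_of_dist_le (by simpa [φ] using hx.1) (le_of_lt hx.2)
  let E : Fin n → SmoothVectorField n M := fun i ↦ ⟨(ρ : M → ℝ) • chartField p i,
    ContMDiffOn.smul_section_of_tsupport ρ.contMDiff.contMDiffOn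
      (isOpen_extChartAt_source (I := 𝓡 n) p) ρ.tsupport_subset_extChartAt_source
      fun x hx ↦ (contMDiffAt_chartField hx i).contMDiffWithinAt⟩
  have hE {x : M} (hx : x ∈ U) (i : Fin n) : E i x = chartField p i x := by
    change ρ x • chartField p i x = _
    rw [hρ hx, one_smul]
  have hEe {x : M} (hx : x ∈ U) (i : Fin n) : ∀ᶠ y in 𝓝 x, E i y = chartField p i y := by
    filter_upwards [hUo.mem_nhds hx] with y hy using hE hy i
  have hr : Metric.ball (φ p) ρ.rIn ⊆ φ.target := by
    refine (Metric.ball_subset_ball ρ.rIn_lt_rOut.le).trans ?_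
    simpa [φ] using ρ.ball_subset
  refine ⟨U, E, chartCoeff p, ⟨mem_extChartAt_source p, Metric.mem_ball_self ρ.rIn_pos⟩, hUo,
    fun x hx i j ↦ ?_, fun x hx w ↦ ?_, fun x hx s hs i ↦ contMDiffAt_chartCoeff (hUs hx) i hs,
    fun x hx i j ↦ ?_, fun f hf x hx i j ↦ ?_, fun a ha hcl ↦ ?_⟩
  · rw [hE hx, chartCoeff_chartField (hUs hx)]
  · simp_rw [hE hx]
    exact sum_chartCoeff_smul (hUs hx) w
  · rw [Filter.EventuallyEq.mlieBracket_vectorField_eq (hEe hx i) (hEe hx j),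
      mlieBracket_chartField (hUs hx)]
  · have hc (i j : Fin n) : mvfderiv (𝓡 n) (fun y ↦ mvfderiv (𝓡 n) f y (E j y)) x (E i x)
        = mvfderiv (𝓡 n) (fun y ↦ mvfderiv (𝓡 n) f y (chartField p j y)) x (chartField p i x) := by
      rw [hE hx]
      refine mvfderiv_congr ?_ _
      filter_upwards [hEe hx j] with y hy
      rw [hy]
    rw [hc, hc, mvfderiv_chartField_comm hUo hUs hf hx]
  · obtain ⟨f, hf, hfa⟩ := exists_potential hr rfl hUo a ha fun x hx i j ↦ by
      simpa only [hE hx] using hcl x hx i j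
    exact ⟨f, hf, fun x hx i ↦ by rw [hE hx, hfa x hx]⟩

/-! ### Connection coefficients and covariant derivatives of local sums -/

/-- The `l`-th component of `∇_{E i} E j` in the frame with dual coframe `c`. -/
def christoffel (D : AffineConnection n M) (E : Fin n → SmoothVectorField n M)
    (c : Fin n → Π x : M, TangentSpace (𝓡 n) x →L[ℝ] ℝ) (i j l : Fin n) (x : M) : ℝ :=
  c l x (D (E j) x (E i x))

/-- The trace of the connection form in the frame `E`, evaluated on `E i`. -/
def traceForm (D : AffineConnection n M) (E : Fin n → SmoothVectorField n M)
    (c : Fin n → Π x : M, TangentSpace (𝓡 n) x →L[ℝ] ℝ) (i : Fin n) (x : M) : ℝ :=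
  ∑ l, christoffel D E c i l l x

theorem covDeriv_sum_smul (D : AffineConnection n M) {ι : Type*} (S : Finset ι)
    (f : ι → M → ℝ) (E : ι → Π x : M, TangentSpace (𝓡 n) x) {x : M}
    (hf : ∀ i, MDifferentiableAt (𝓡 n) 𝓘(ℝ, ℝ) (f i) x)
    (hE : ∀ i, MDifferentiableAt (𝓡 n) (𝓡 n).tangent (T% (E i)) x) :
    D (fun y ↦ ∑ i ∈ S, f i y • E i y) x
      = ∑ i ∈ S, (f i x • D (E i) x + (mvfderiv (𝓡 n) (f i) x).smulRight (E i x)) := by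
  classical
  induction S using Finset.induction_on with
  | empty =>
    simp only [Finset.sum_empty]
    exact D.isCovariantDerivativeOn.zero
  | insert a S ha ih =>
    simp only [Finset.sum_insert ha]
    rw [← ih, ← D.isCovariantDerivativeOn.leibniz (hE a) (hf a)]
    exact D.isCovariantDerivativeOn.add ((hf a).smul_section (hE a))
      (MDifferentiableAt.sum_section fun i _ ↦ (hf i).smul_section (hE i))

theorem contMDiffAt_covDeriv {D : AffineConnection n M} (hD : D.IsSmooth)
    (Z X : SmoothVectorField n M) (x : M) :
    ContMDiffAt (𝓡 n) (𝓡 n).tangent ∞ (T% (fun y ↦ D Z y (X y))) x := by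
  have h := hD.contMDiff.contMDiff (σ := Z) Z.contMDiff.contMDiffOn
  exact (h.contMDiffAt Filter.univ_mem : ContMDiffAt _ _ _ _ x).clm_bundle_apply
    X.contMDiff.contMDiffAt

theorem mdifferentiableAt_smoothVectorField (X : SmoothVectorField n M) (x : M) :
    MDifferentiableAt (𝓡 n) (𝓡 n).tangent (T% (fun y ↦ X y)) x :=
  X.contMDiff.contMDiffAt.mdifferentiableAt (by simp)

theorem contMDiffAt_inner (g : Metric n M) (X Y : SmoothVectorField n M) (x : M) :
    ContMDiffAt (𝓡 n) 𝓘(ℝ, ℝ) ∞ (fun y ↦ g.inner y (X y) (Y y)) x := by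
  have : ContMDiffAt (𝓡 n) ((𝓡 n).prod 𝓘(ℝ)) ∞
      (fun m ↦ TotalSpace.mk' ℝ (E := Bundle.Trivial M ℝ) m (g.inner m (X m) (Y m))) x := by
    apply ContMDiffAt.clm_bundle_apply₂ (F₁ := EuclideanSpace ℝ (Fin n))
      (F₂ := EuclideanSpace ℝ (Fin n))
    · exact g.contMDiff.contMDiffAt
    · exact X.contMDiff.contMDiffAt
    · exact Y.contMDiff.contMDiffAt
  simp only [contMDiffAt_totalSpace] at this
  exact this.2

/-- `e^f` times the coordinate volume form. -/
def expVolume (c : Fin n → Π x : M, TangentSpace (𝓡 n) x →L[ℝ] ℝ) (f : M → ℝ) :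
    TopForm n M := fun x ↦
  Real.exp (f x) • (detForm n).compContinuousLinearMap (ContinuousLinearMap.pi fun i ↦ c i x)

/-! ### Curvature, traces and volume forms in a coordinate frame -/

namespace IsCoordinateFrame

variable {U : Set M} {E : Fin n → SmoothVectorField n M}
  {c : Fin n → Π x : M, TangentSpace (𝓡 n) x →L[ℝ] ℝ}

/-- Near x one has s = Σ cᵢ(s) Eᵢ, so locality and the Leibniz rule apply. Smoothness of s is asked
only at x, which allows s = ∇_{Eᵢ} Eⱼ in the curvature. -/
theorem coeff_covDeriv (h : IsCoordinateFrame U E c) (D : AffineConnection n M) {x : M}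
    (hx : x ∈ U) {s : Π x : M, TangentSpace (𝓡 n) x}
    (hs : ContMDiffAt (𝓡 n) (𝓡 n).tangent ∞ (T% s) x) (v : TangentSpace (𝓡 n) x) (l : Fin n) :
    c l x (D s x v) = mvfderiv (𝓡 n) (fun y ↦ c l y (s y)) x v
      + ∑ m, c m x (s x) * c l x (D (E m) x v) := by
  have hf (i : Fin n) : MDifferentiableAt (𝓡 n) 𝓘(ℝ, ℝ) (fun y ↦ c i y (s y)) x :=
    (h.contMDiffAt_coeff x hx s hs i).mdifferentiableAt (by simp)
  have hE (i : Fin n) : MDifferentiableAt (𝓡 n) (𝓡 n).tangent (T% (fun y ↦ E i y)) x :=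
    (E i).contMDiff.contMDiffAt.mdifferentiableAt (by simp)
  have he : D s x = D (fun y ↦ ∑ i, c i y (s y) • E i y) x := by
    refine D.isCovariantDerivativeOn.congr_of_eventuallyEq (s := Set.univ)
      (hs.mdifferentiableAt (by simp))
      (MDifferentiableAt.sum_section fun i _ ↦ (hf i).smul_section (hE i)) Filter.univ_mem ?_
    filter_upwards [h.isOpen.mem_nhds hx] with y hy using (h.sum_coeff_smul y hy (s y)).symm
  rw [he, covDeriv_sum_smul D _ _ _ hf hE, _root_.sum_apply, map_sum]
  simp [Finset.sum_add_distrib, h.coeff_frame x hx]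
  rw [add_comm]

theorem contMDiffOn_christoffel (h : IsCoordinateFrame U E c) {D : AffineConnection n M}
    (hD : D.IsSmooth) (i j l : Fin n) :
    ContMDiffOn (𝓡 n) 𝓘(ℝ, ℝ) ∞ (christoffel D E c i j l) U := fun x hx ↦
  (h.contMDiffAt_coeff x hx _ (contMDiffAt_covDeriv hD (E j) (E i) x) l).contMDiffWithinAt

theorem mdifferentiableAt_christoffel (h : IsCoordinateFrame U E c) {D : AffineConnection n M}
    (hD : D.IsSmooth) {x : M} (hx : x ∈ U) (i j l : Fin n) :
    MDifferentiableAt (𝓡 n) 𝓘(ℝ, ℝ) (christoffel D E c i j l) x :=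
  ((h.contMDiffOn_christoffel hD i j l).contMDiffAt (h.isOpen.mem_nhds hx)).mdifferentiableAt
    (by simp)

theorem contMDiffOn_traceForm (h : IsCoordinateFrame U E c) {D : AffineConnection n M}
    (hD : D.IsSmooth) (i : Fin n) : ContMDiffOn (𝓡 n) 𝓘(ℝ, ℝ) ∞ (traceForm D E c i) U :=
  contMDiffOn_finsetSum fun l _ ↦ h.contMDiffOn_christoffel hD i l l

/-- L is the sum of the rank-one maps w ↦ cᵢ(w) L(Eᵢ), whose traces are cᵢ(L Eᵢ). -/
theorem trace_eq_sum (h : IsCoordinateFrame U E c) {x : M} (hx : x ∈ U)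
    (L : TangentSpace (𝓡 n) x →ₗ[ℝ] TangentSpace (𝓡 n) x) :
    LinearMap.trace ℝ (TangentSpace (𝓡 n) x) L = ∑ i, c i x (L (E i x)) := by
  have : L = ∑ i, (c i x : TangentSpace (𝓡 n) x →ₗ[ℝ] ℝ).smulRight (L (E i x)) := by
    ext w
    conv_lhs => rw [← h.sum_coeff_smul x hx w]
    simp
  conv_lhs => rw [this]
  have : Module.Free ℝ (TangentSpace (𝓡 n) x) :=
    inferInstanceAs (Module.Free ℝ (EuclideanSpace ℝ (Fin n)))
  have : Module.Finite ℝ (TangentSpace (𝓡 n) x) :=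
    inferInstanceAs (Module.Finite ℝ (EuclideanSpace ℝ (Fin n)))
  simp [LinearMap.trace_smulRight]

theorem coeff_curvature (h : IsCoordinateFrame U E c) {D : AffineConnection n M}
    (hD : D.IsSmooth) {x : M} (hx : x ∈ U) (i j k l : Fin n) :
    c l x (curvature D (E i) (E j) (E k) x) =
      (mvfderiv (𝓡 n) (christoffel D E c j k l) x (E i x)
        + ∑ m, christoffel D E c j k m x * christoffel D E c i m l x)
      - (mvfderiv (𝓡 n) (christoffel D E c i k l) x (E j x)
        + ∑ m, christoffel D E c i k m x * christoffel D E c j m l x) := by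
  unfold curvature
  rw [h.mlieBracket_eq_zero x hx, map_zero, sub_zero, map_sub,
    h.coeff_covDeriv D hx (contMDiffAt_covDeriv hD (E k) (E j) x),
    h.coeff_covDeriv D hx (contMDiffAt_covDeriv hD (E k) (E i) x)]
  rfl

theorem ricci_eq (h : IsCoordinateFrame U E c) {D : AffineConnection n M}
    (hD : D.IsSmooth) {x : M} (hx : x ∈ U) (j k : Fin n) :
    ricci D hD (E j) (E k) x = ∑ i,
      ((mvfderiv (𝓡 n) (christoffel D E c j k i) x (E i x)
        + ∑ m, christoffel D E c j k m x * christoffel D E c i m i x)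
      - (mvfderiv (𝓡 n) (christoffel D E c i k i) x (E j x)
        + ∑ m, christoffel D E c i k m x * christoffel D E c j m i x)) := by
  unfold ricci
  rw [h.trace_eq_sum hx]
  refine Finset.sum_congr rfl fun i _ ↦ ?_
  rw [← h.coeff_curvature hD hx]
  congr 1
  exact TensorialAt.mkHom_apply (tensorialAt_curvature D hD (E j) (E k) x)
    (mdifferentiableAt_smoothVectorField (E i) x)

theorem christoffel_symm (h : IsCoordinateFrame U E c) {D : AffineConnection n M}
    (ht : D.torsion = 0) {x : M} (hx : x ∈ U) (i j l : Fin n) :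
    christoffel D E c i j l x = christoffel D E c j i l x := by
  have := D.torsion_eq_zero_iff.1 ht (mdifferentiableAt_smoothVectorField (E i) x)
    (mdifferentiableAt_smoothVectorField (E j) x)
  rw [h.mlieBracket_eq_zero x hx, sub_eq_zero] at this
  exact congrArg (c l x) this

/-- For a torsion-free connection the skew part of the Ricci tensor is the exterior derivative of
the trace of the connection form. -/
theorem ricci_sub_ricci_swap (h : IsCoordinateFrame U E c) {D : AffineConnection n M}
    (hD : D.IsSmooth) (ht : D.torsion = 0) {x : M} (hx : x ∈ U) (j k : Fin n) :
    ricci D hD (E j) (E k) x - ricci D hD (E k) (E j) x =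
      mvfderiv (𝓡 n) (traceForm D E c j) x (E k x)
        - mvfderiv (𝓡 n) (traceForm D E c k) x (E j x) := by
  have hs (i j l : Fin n) (v : TangentSpace (𝓡 n) x) :
      mvfderiv (𝓡 n) (christoffel D E c i j l) x v
        = mvfderiv (𝓡 n) (christoffel D E c j i l) x v := by
    refine mvfderiv_congr ?_ v
    filter_upwards [h.isOpen.mem_nhds hx] with y hy using h.christoffel_symm ht hy i j l
  have hd (j : Fin n) (v : TangentSpace (𝓡 n) x) : mvfderiv (𝓡 n) (traceForm D E c j) x v
      = ∑ i, mvfderiv (𝓡 n) (christoffel D E c j i i) x v :=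
    mvfderiv_finsetSum _ (fun i ↦ h.mdifferentiableAt_christoffel hD hx j i i) v
  -- The contraction of ΓΓ is symmetric in j and k: exchange the summation indices and use the
  -- symmetry of Γ.
  have hq (j k : Fin n) : ∑ i, ∑ m, christoffel D E c i k m x * christoffel D E c j m i x
      = ∑ i, ∑ m, christoffel D E c i j m x * christoffel D E c k m i x := by
    rw [Finset.sum_comm]
    refine Finset.sum_congr rfl fun m _ ↦ Finset.sum_congr rfl fun i _ ↦ ?_
    rw [h.christoffel_symm ht hx i k, h.christoffel_symm ht hx j m, mul_comm]
  rw [h.ricci_eq hD hx, h.ricci_eq hD hx, hd, hd]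
  simp only [Finset.sum_sub_distrib, Finset.sum_add_distrib]
  rw [hq j k]
  -- The remaining terms built from Γ with lower indices j, k are symmetric and cancel, leaving only
  -- derivatives of the contracted symbols.
  simp_rw [hs k j, h.christoffel_symm ht hx k j, hs j, hs k]
  ring

/-- A kernel vector v of the Gram matrix makes Σ vᵢEᵢ have length zero, hence vanish; the coframe
then gives v = 0. -/
theorem detForm_inner_ne_zero (h : IsCoordinateFrame U E c) (g : Metric n M) {x : M}
    (hx : x ∈ U) : detForm n (fun i j ↦ g.inner x (E i x) (E j x)) ≠ 0 := by
  rw [detForm_apply]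
  intro h0
  obtain ⟨v, hv, hv0⟩ := Matrix.exists_mulVec_eq_zero_iff.2 h0
  have hz : ∑ i, v i • E i x = 0 := by
    by_contra hne
    have hp := g.pos x _ hne
    have : g.inner x (∑ i, v i • E i x) (∑ i, v i • E i x) = v ⬝ᵥ (Matrix.of
        (fun i j ↦ g.inner x (E i x) (E j x))).mulVec v := by
      simp [Matrix.mulVec, dotProduct, _root_.sum_apply, Finset.mul_sum, mul_comm]
      refine Finset.sum_congr rfl fun i _ ↦ Finset.sum_congr rfl fun j _ ↦ ?_
      rw [g.symm]
    rw [this, hv0] at hp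
    simp at hp
  apply hv
  ext i
  have := congrArg (c i x) hz
  simpa [h.coeff_frame x hx] using this

/-- The metric duality determines the sum of the traces: it is `d log det g`. -/
theorem mvfderiv_log_det_inner (h : IsCoordinateFrame U E c) {g : Metric n M}
    {D D' : AffineConnection n M} (hdual : IsDual g D D') {x : M} (hx : x ∈ U) (k : Fin n) :
    mvfderiv (𝓡 n) (fun y ↦ Real.log (detForm n fun i j ↦ g.inner y (E i y) (E j y))) x (E k x)
      = traceForm D E c k x + traceForm D' E c k x := by
  have h0 := h.detForm_inner_ne_zero g hx
  have hsm (i j : Fin n) : ContMDiffAt (𝓡 n) 𝓘(ℝ, ℝ) ∞ (fun y ↦ g.inner y (E i y) (E j y)) x :=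
    contMDiffAt_inner g (E i) (E j) x
  have hdet : MDifferentiableAt (𝓡 n) 𝓘(ℝ, ℝ)
      (fun y ↦ detForm n fun i j ↦ g.inner y (E i y) (E j y)) x :=
    (contMDiffAt_detForm hsm).mdifferentiableAt (by simp)
  let G : Matrix (Fin n) (Fin n) ℝ := .of fun i j ↦ g.inner x (E i x) (E j x)
  let A : Matrix (Fin n) (Fin n) ℝ := .of fun i m ↦ christoffel D E c k i m x
  let A' : Matrix (Fin n) (Fin n) ℝ := .of fun i m ↦ christoffel D' E c k i m x
  have hexp (D : AffineConnection n M) (i : Fin n) :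
      D (E i) x (E k x) = ∑ m, christoffel D E c k i m x • E m x :=
    (h.sum_coeff_smul x hx _).symm
  -- The duality relation in matrix form. By Jacobi's formula and G · adj G = det G, it yields det G
  -- · (tr A + tr A').
  have hG : (Matrix.of fun i j ↦ mvfderiv (𝓡 n) (fun y ↦ g.inner y (E i y) (E j y)) x (E k x))
      = A * G + G * A'.transpose := by
    ext i j
    rw [Matrix.of_apply, hdual, hexp D, hexp D']
    simp [A, A', G, Matrix.mul_apply, _root_.sum_apply, mul_comm]
  rw [mvfderiv_hasFDerivAt_comp (G := Real.log)
      (f := fun y ↦ detForm n fun i j ↦ g.inner y (E i y) (E j y))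
      (Real.hasDerivAt_log h0).hasFDerivAt hdet,
    mvfderiv_det hsm, hG, add_mul, Matrix.trace_add, mul_assoc, Matrix.mul_adjugate,
    mul_assoc, Matrix.trace_mul_comm G, mul_assoc, Matrix.adjugate_mul]
  simp only [Matrix.mul_smul, mul_one, Matrix.trace_smul, Matrix.trace_transpose]
  have hdG : detForm n (fun i j ↦ g.inner x (E i x) (E j x)) = G.det := rfl
  rw [hdG] at h0 ⊢
  have hA : A.trace = traceForm D E c k x := rfl
  have hA' : A'.trace = traceForm D' E c k x := rfl
  simp [hA, hA']
  field_simp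
  exact (mul_add _ _ _).symm


/-- For conjugate Ricci-symmetric dual torsion-free connections the traces of both connection
forms are closed. -/
theorem mvfderiv_traceForm_comm (h : IsCoordinateFrame U E c) {g : Metric n M}
    {D D' : AffineConnection n M} (hD : D.IsSmooth) (hD' : D'.IsSmooth) (ht : D.torsion = 0)
    (ht' : D'.torsion = 0) (hdual : IsDual g D D') (hric : ConjugateRicciSymmetric D D' hD hD')
    {x : M} (hx : x ∈ U) (i j : Fin n) :
    mvfderiv (𝓡 n) (traceForm D E c j) x (E i x) = mvfderiv (𝓡 n) (traceForm D E c i) x (E j x) ∧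
    mvfderiv (𝓡 n) (traceForm D' E c j) x (E i x)
      = mvfderiv (𝓡 n) (traceForm D' E c i) x (E j x) := by
  have h1 := h.ricci_sub_ricci_swap hD ht hx i j
  have h2 := h.ricci_sub_ricci_swap hD' ht' hx i j
  -- With `h2` this says dτ = dτ*.
  rw [hric, hric] at h1
  have hsum (i j : Fin n) : mvfderiv (𝓡 n) (fun y ↦ mvfderiv (𝓡 n) (fun y ↦ Real.log
        (detForm n fun i j ↦ g.inner y (E i y) (E j y))) y (E j y)) x (E i x)
      = mvfderiv (𝓡 n) (traceForm D E c j) x (E i x)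
        + mvfderiv (𝓡 n) (traceForm D' E c j) x (E i x) := by
    have hd {D : AffineConnection n M} (hD : D.IsSmooth) :
        MDifferentiableAt (𝓡 n) 𝓘(ℝ, ℝ) (traceForm D E c j) x :=
      ((h.contMDiffOn_traceForm hD j).contMDiffAt (h.isOpen.mem_nhds hx)).mdifferentiableAt
        (by simp)
    have ha := DFunLike.congr_fun (mvfderiv_add (hd hD) (hd hD')) (E i x)
    refine (mvfderiv_congr ?_ _).trans ha
    filter_upwards [h.isOpen.mem_nhds hx] with y hy using h.mvfderiv_log_det_inner hdual hy j
  -- Symmetry of the second derivatives of log det g, that is, d(τ + τ*) = 0.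
  have h3 := h.mvfderiv_comm (fun y ↦ Real.log (detForm n fun i j ↦ g.inner y (E i y) (E j y)))
    (fun y hy ↦ ((Real.contDiffAt_log.2 (h.detForm_inner_ne_zero g hy)).contMDiffAt.comp y
      (contMDiffAt_detForm fun i j ↦ contMDiffAt_inner g (E i) (E j) y)).contMDiffWithinAt) x hx i j
  rw [hsum, hsum] at h3
  constructor <;> linarith

theorem isVolumeFormOn_expVolume (h : IsCoordinateFrame U E c) {f : M → ℝ}
    (hf : ContMDiffOn (𝓡 n) 𝓘(ℝ, ℝ) ∞ f U) : IsVolumeFormOn (expVolume c f) U where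
  smooth Y hY x hx := by
    have hd := contMDiffAt_detForm (A := fun y i j ↦ c j y (Y i y)) fun i j ↦
      h.contMDiffAt_coeff x hx (Y i) ((hY i).contMDiffAt (h.isOpen.mem_nhds hx)) j
    have he : ContMDiffAt (𝓡 n) 𝓘(ℝ, ℝ) ∞ (fun y ↦ Real.exp (f y)) x :=
      Real.contDiff_exp.contMDiff.contMDiffAt.comp x (hf.contMDiffAt (h.isOpen.mem_nhds hx))
    exact (he.mul hd).contMDiffWithinAt
  ne_zero x hx h0 := by
    have h1 : expVolume c f x (fun i ↦ E i x) = Real.exp (f x) * detForm n fun i j ↦ c j x (E i x) :=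
      rfl
    have h2 : (Matrix.of fun i j ↦ c j x (E i x)) = 1 := by
      ext i j
      simp [h.coeff_frame x hx, Matrix.one_apply, eq_comm]
    rw [detForm_apply, h2, h0] at h1
    exact Real.exp_ne_zero (f x) (by simpa using h1.symm)

/-- With y the coordinate matrix of the Yᵢ, the tr(dy · adj y) terms cancel, leaving e^f det y ·
(df(v) − tr A), where tr A = τ(v) = df(v). -/
theorem isParallelOn_expVolume (h : IsCoordinateFrame U E c) (D : AffineConnection n M)
    {f : M → ℝ} (hf : ContMDiffOn (𝓡 n) 𝓘(ℝ, ℝ) ∞ f U)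
    (hfa : ∀ x ∈ U, ∀ i, mvfderiv (𝓡 n) f x (E i x) = traceForm D E c i x) :
    IsParallelOn D (expVolume c f) U := by
  intro Y hY x hx v
  have hYx (i : Fin n) := (hY i).contMDiffAt (h.isOpen.mem_nhds hx)
  have hsm (i j : Fin n) : ContMDiffAt (𝓡 n) 𝓘(ℝ, ℝ) ∞ (fun y ↦ c j y (Y i y)) x :=
    h.contMDiffAt_coeff x hx (Y i) (hYx i) j
  have hfx : MDifferentiableAt (𝓡 n) 𝓘(ℝ, ℝ) f x :=
    (hf.contMDiffAt (h.isOpen.mem_nhds hx)).mdifferentiableAt (by simp)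
  have he : MDifferentiableAt (𝓡 n) 𝓘(ℝ, ℝ) (fun y ↦ Real.exp (f y)) x :=
    Real.differentiableAt_exp.mdifferentiableAt.comp x hfx
  have hdet : MDifferentiableAt (𝓡 n) 𝓘(ℝ, ℝ) (fun y ↦ detForm n fun i j ↦ c j y (Y i y)) x :=
    (contMDiffAt_detForm hsm).mdifferentiableAt (by simp)
  let y : Matrix (Fin n) (Fin n) ℝ := .of fun i j ↦ c j x (Y i x)
  let dy : Matrix (Fin n) (Fin n) ℝ := .of fun i j ↦ mvfderiv (𝓡 n) (fun z ↦ c j z (Y i z)) x v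
  let A : Matrix (Fin n) (Fin n) ℝ := .of fun m l ↦ c l x (D (E m) x v)
  have htr : A.trace = mvfderiv (𝓡 n) f x v := by
    conv_rhs => rw [← h.sum_coeff_smul x hx v]
    conv_lhs => rw [Matrix.trace]; simp only [Matrix.diag_apply, A, Matrix.of_apply]
    simp only [map_sum, map_smul, smul_eq_mul, hfa x hx, traceForm, christoffel, Finset.mul_sum]
    rw [Finset.sum_comm]
    refine Finset.sum_congr rfl fun m _ ↦ ?_
    conv_lhs => rw [← h.sum_coeff_smul x hx v]
    simp
  have hsum : ∑ i, expVolume c f x (Function.update (fun j ↦ Y j x) i (D (Y i) x v))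
      = Real.exp (f x) * ((dy + y * A) * y.adjugate).trace := by
    rw [← sum_det_updateRow, Finset.mul_sum]
    refine Finset.sum_congr rfl fun i _ ↦ ?_
    -- The coordinates of ∇_v Yᵢ form row i of dy + yA, so each summand is a determinant with one
    -- row replaced.
    have hB : (Matrix.of fun a b ↦ c b x (Function.update (fun j ↦ Y j x) i (D (Y i) x v) a))
        = y.updateRow i ((dy + y * A) i) := by
      ext a b
      rcases eq_or_ne a i with rfl | ha
      · simp [h.coeff_covDeriv D hx (hYx a), dy, y, A, Matrix.mul_apply]
      · simp [ha, y]
    rw [← hB]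
    rfl
  have hmul := DFunLike.congr_fun (mvfderiv_mul he hdet) v
  unfold covDerivForm
  rw [hsum]
  have hlhs : mvfderiv (𝓡 n) (fun y ↦ expVolume c f y fun i ↦ Y i y) x v
      = Real.exp (f x) * (dy * y.adjugate).trace
        + y.det * (Real.exp (f x) * mvfderiv (𝓡 n) f x v) := by
    refine hmul.trans ?_
    have h1 := mvfderiv_hasFDerivAt_comp (Real.hasDerivAt_exp (f x)).hasFDerivAt hfx v
    have h2 := mvfderiv_det hsm v
    simp [h1, h2, dy, y]
    rw [detForm_apply]
    ring
  rw [hlhs, add_mul, Matrix.trace_add, mul_assoc, Matrix.trace_mul_comm y, mul_assoc,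
    Matrix.adjugate_mul]
  simp [htr]
  ring

end IsCoordinateFrame

/-! ### From global fields to tangent vectors; torsion of the dual connection -/

theorem inner_right_injective (g : Metric n M) {x : M} {v w : TangentSpace (𝓡 n) x}
    (h : ∀ u, g.inner x u v = g.inner x u w) : v = w := by
  by_contra hne
  have := g.pos x (v - w) (sub_ne_zero.2 hne)
  rw [map_sub, h, sub_self] at this
  exact lt_irrefl _ this

/-- A combination of the global frame fields with coefficients frozen at x suffices. It transfers
identities between global fields to tangent vectors. -/
theorem exists_smoothVectorField_eq [T2Space M] {x : M} (v : TangentSpace (𝓡 n) x) :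
    ∃ X : SmoothVectorField n M, X x = v := by
  obtain ⟨U, E, c, hx, h⟩ := exists_isCoordinateFrame (n := n) x
  refine ⟨∑ i, c i x v • E i, ?_⟩
  have hs := map_sum (ContMDiffSection.coeAddHom (𝓡 n) (EuclideanSpace ℝ (Fin n)) ∞
    (TangentSpace (𝓡 n) : M → Type _)) (fun i ↦ c i x v • E i) Finset.univ
  refine (congrFun hs x).trans ?_
  rw [Finset.sum_apply]
  exact h.sum_coeff_smul x hx v

theorem torsion_eq_zero_of_smooth [T2Space M] {D : AffineConnection n M}
    (h : ∀ (X Y : SmoothVectorField n M) (x : M),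
      D Y x (X x) - D X x (Y x) = mlieBracket (𝓡 n) X Y x) : D.torsion = 0 := by
  ext1 x
  ext u v
  obtain ⟨X, rfl⟩ := exists_smoothVectorField_eq u
  obtain ⟨Y, rfl⟩ := exists_smoothVectorField_eq v
  rw [D.torsion_apply (mdifferentiableAt_smoothVectorField X x)
    (mdifferentiableAt_smoothVectorField Y x), h, sub_self]
  rfl

/-- The dual connection of a statistical structure is torsion-free. -/
theorem IsStatistical.torsion_dual_eq_zero [T2Space M] {g : Metric n M}
    {D D' : AffineConnection n M} (hstat : IsStatistical g D) (hdual : IsDual g D D') :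
    D'.torsion = 0 := by
  -- Duality turns Q(X,Y,Z) into g(Y, (∇* − ∇)_X Z), so symmetry of Q in X and Z makes ∇* − ∇
  -- symmetric, and the two torsions agree.
  have hQ (X Y Z : SmoothVectorField n M) (x : M) : cubicForm g D X Y Z x
      = g.inner x (Y x) (D' Z x (X x)) - g.inner x (Y x) (D Z x (X x)) := by
    unfold cubicForm
    rw [hdual]
    ring
  refine torsion_eq_zero_of_smooth fun X Z x ↦ ?_
  have hD := D.torsion_eq_zero_iff.1 hstat.torsion_free (mdifferentiableAt_smoothVectorField X x)
    (mdifferentiableAt_smoothVectorField Z x)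
  rw [← hD, sub_eq_sub_iff_add_eq_add]
  refine inner_right_injective g fun u ↦ ?_
  obtain ⟨Y, rfl⟩ := exists_smoothVectorField_eq u
  have h1 : cubicForm g D X Y Z x = cubicForm g D Z Y X x := by
    rw [hstat.cubic_symm_right X Y Z, hstat.cubic_symm_left X Z Y, hstat.cubic_symm_right Z X Y]
  rw [hQ, hQ] at h1
  rw [map_add, map_add]
  linarith

/-! ### The α-connections -/

theorem isSmooth_alphaConnection {D D' : AffineConnection n M} (hD : D.IsSmooth)
    (hD' : D'.IsSmooth) (α : ℝ) : (alphaConnection D D' α).IsSmooth where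
  contMDiff := ⟨fun hσ ↦ ContMDiffOn.add_section
    (contMDiffOn_const.smul_section (hD.contMDiff.contMDiff hσ))
    (contMDiffOn_const.smul_section (hD'.contMDiff.contMDiff hσ))⟩

theorem torsion_alphaConnection {D D' : AffineConnection n M} (ht : D.torsion = 0)
    (ht' : D'.torsion = 0) (α : ℝ) : (alphaConnection D D' α).torsion = 0 := by
  refine (CovariantDerivative.torsion_eq_zero_iff _).2 fun {X Y x} hX hY ↦ ?_
  have h := D.torsion_eq_zero_iff.1 ht hX hY
  have h' := D'.torsion_eq_zero_iff.1 ht' hX hY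
  change (((1 + α) / 2) • D Y x (X x) + ((1 - α) / 2) • D' Y x (X x))
    - (((1 + α) / 2) • D X x (Y x) + ((1 - α) / 2) • D' X x (Y x)) = _
  calc _ = ((1 + α) / 2) • (D Y x (X x) - D X x (Y x))
        + ((1 - α) / 2) • (D' Y x (X x) - D' X x (Y x)) := by module
    -- The weights (1+α)/2 and (1−α)/2 sum to 1, so exactly one copy of the bracket results.
    _ = _ := by rw [h, h']; module

theorem traceForm_alphaConnection (D D' : AffineConnection n M) (α : ℝ)
    (E : Fin n → SmoothVectorField n M) (c : Fin n → Π x : M, TangentSpace (𝓡 n) x →L[ℝ] ℝ)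
    (i : Fin n) (x : M) : traceForm (alphaConnection D D' α) E c i x
      = ((1 + α) / 2) * traceForm D E c i x + ((1 - α) / 2) * traceForm D' E c i x := by
  simp only [traceForm, Finset.mul_sum, ← Finset.sum_add_distrib]
  refine Finset.sum_congr rfl fun l _ ↦ ?_
  change c l x (((1 + α) / 2) • D (E l) x (E i x) + ((1 - α) / 2) • D' (E l) x (E i x)) = _
  simp [christoffel]

end StatMfd
end

theorem corollary3p1 {n : ℕ} {M : Type*} [TopologicalSpace M] [T2Space M]
    [ChartedSpace (EuclideanSpace ℝ (Fin n)) M] [IsManifold (𝓡 n) ∞ M]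
    (g : StatMfd.Metric n M) (D D' : StatMfd.AffineConnection n M)
    (hD : D.IsSmooth) (hD' : D'.IsSmooth)
    (hstat : StatMfd.IsStatistical g D) (hdual : StatMfd.IsDual g D D')
    (hricci : StatMfd.ConjugateRicciSymmetric D D' hD hD') (α : ℝ) :
    StatMfd.IsEquiaffine (StatMfd.alphaConnection D D' α) := by
  have ht := hstat.torsion_free
  have ht' := hstat.torsion_dual_eq_zero hdual
  have hα := StatMfd.isSmooth_alphaConnection hD hD' α
  refine ⟨hα, StatMfd.torsion_alphaConnection ht ht' α, fun p ↦ ?_⟩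
  obtain ⟨U, E, c, hp, h⟩ := StatMfd.exists_isCoordinateFrame (n := n) p
  obtain ⟨f, hf, hfa⟩ := h.exists_potential _ (h.contMDiffOn_traceForm hD) fun x hx i j ↦
    (h.mvfderiv_traceForm_comm hD hD' ht ht' hdual hricci hx i j).1
  obtain ⟨f', hf', hfa'⟩ := h.exists_potential _ (h.contMDiffOn_traceForm hD') fun x hx i j ↦
    (h.mvfderiv_traceForm_comm hD hD' ht ht' hdual hricci hx i j).2
  -- The same affine combination of potentials as of connections.
  have hF : ContMDiffOn (𝓡 n) 𝓘(ℝ, ℝ) ∞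
      (fun x ↦ ((1 + α) / 2) * f x + ((1 - α) / 2) * f' x) U :=
    (contMDiffOn_const.mul hf).add (contMDiffOn_const.mul hf')
  refine ⟨U, h.isOpen, hp, StatMfd.expVolume c _, h.isVolumeFormOn_expVolume hF,
    h.isParallelOn_expVolume _ hF fun x hx i ↦ ?_⟩
  have hfx := (hf.contMDiffAt (h.isOpen.mem_nhds hx)).mdifferentiableAt (by simp)
  have hfx' := (hf'.contMDiffAt (h.isOpen.mem_nhds hx)).mdifferentiableAt (by simp)
  rw [StatMfd.traceForm_alphaConnection, ← hfa x hx, ← hfa' x hx]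
  exact StatMfd.mvfderiv_linear_combination hfx hfx' _ _ _
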